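/- **Theorem 3.2.** A signed graph $\Gamma=(G,\sigma)$ is a finite simple graph $G$ with a sign function $\sigma:E(G)\to\{+1,-1\}$; its adjacency matrix has $(u,v)$-entry $\sigma(uv)$ if $uv\in E(G)$ and $0$ otherwise. Let $i_+(\Gamma)$ be the number of positive eigenvalues of this matrix (with multiplicity), $p(\Gamma)$ the number of vertices of degree $1$, and $\theta(\Gamma)=|E(G)|-|V(G)|+c(G)$, where $c(G)$ is the number of connected components of $G$. A signed graph is balanced if the product of the edge signs along each of its cycles is $+1$, and unbalanced otherwise. Isomorphisms of signed graphs preserve edge signs, and a signed cycle $C_m^{\sigma}$ is the cycle on $m\ge 3$ vertices with some sign function. Let $\Gamma$ be a signed graph of order $n$ each of whose connected components has at least two vertices. Then $$i_+(\Gamma)=\frac{n-p(\Gamma)}{2}-\theta(\Gamma)$$ if and only if $\Gamma$ is isomorphic to a disjoint union $C_{n_1}^{\sigma}\cup C_{n_2}^{\sigma}\cup\cdots\cup C_{n_t}^{\sigma}$ of signed cycles, where $n_1+n_2+\cdots+n_t=n$ and, for each $i\in\{1,\dots,t\}$, $n_i\equiv 0\pmod 4$ if $C_{n_i}^{\sigma}$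 is balanced and $n_i\equiv 2\pmod 4$ if $C_{n_i}^{\sigma}$ is unbalanced. (For the empty graph, $t=0$.) -/

import Mathlib

/-- A signed graph on the vertex set `V`: a simple graph together with a sign function on its
edges, with values in `ℤˣ = {1, -1}`. -/
structure SignedGraph (V : Type*) where
  /-- The underlying simple graph. -/
  graph : SimpleGraph V
  /-- The sign function. -/
  sign : graph.edgeSet → ℤˣ

namespace SignedGraph

/-- The sign of a walk: the product of the signs of the edges it runs through, counted with
multiplicity. On a cycle, whose edges are distinct, this is the sign of the cycle. -/
def walkSign {V : Type*} (Γ : SignedGraph V) {u v : V} (w : Γ.graph.Walk u v) : ℤˣ :=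
  (w.edges.attach.map fun e => Γ.sign ⟨e.1, w.edges_subset_edgeSet e.2⟩).prod

/-- A signed graph is balanced if all of its cycles are positive. -/
def Balanced {V : Type*} (Γ : SignedGraph V) : Prop :=
  ∀ (v : V) (w : Γ.graph.Walk v v), w.IsCycle → Γ.walkSign w = 1

open scoped Classical in
/-- The adjacency matrix: the sign of `uv` at an edge `uv`, and `0` elsewhere. -/
noncomputable def adjMatrix {V : Type*} (Γ : SignedGraph V) : Matrix V V ℝ :=
  Matrix.of fun u v => if h : Γ.graph.Adj u v then ((Γ.sign ⟨s(u, v), h⟩ : ℤ) : ℝ) else 0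

theorem adjMatrix_isHermitian {V : Type*} (Γ : SignedGraph V) : Γ.adjMatrix.IsHermitian := by
  ext u v
  simp only [Matrix.conjTranspose_apply, adjMatrix, Matrix.of_apply, star_trivial]
  by_cases h : Γ.graph.Adj u v
  · have e : (⟨s(v, u), h.symm⟩ : Γ.graph.edgeSet) = ⟨s(u, v), h⟩ := Subtype.ext Sym2.eq_swap
    rw [dif_pos h, dif_pos h.symm, e]
  · rw [dif_neg h, dif_neg (fun h' => h h'.symm)]

open scoped Classical in
/-- The positive inertia index: the number of positive eigenvalues of the adjacency matrix,
counted with multiplicity. -/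
noncomputable def posInertia {V : Type*} [Fintype V] (Γ : SignedGraph V) : ℕ :=
  (Finset.univ.filter fun i : V => 0 < Γ.adjMatrix_isHermitian.eigenvalues i).card

open scoped Classical in
/-- The number of pendant vertices, that is, of vertices of degree `1`. -/
noncomputable def pendantCount {V : Type*} [Fintype V] (Γ : SignedGraph V) : ℕ :=
  (Finset.univ.filter fun v : V => Γ.graph.degree v = 1).card

/-- The cyclomatic number `|E| - |V| + c`, where `c` is the number of connected components. -/
noncomputable def cyclomaticNumber {V : Type*} (Γ : SignedGraph V) : ℤ :=
  (Nat.card Γ.graph.edgeSet : ℤ) - (Nat.card V : ℤ) + (Nat.card Γ.graph.ConnectedComponent : ℤ)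

/-- Two signed graphs are isomorphic if there is an isomorphism of their underlying graphs that
preserves the sign of every edge. -/
def Isomorphic {V W : Type*} (Γ : SignedGraph V) (Δ : SignedGraph W) : Prop :=
  ∃ φ : Γ.graph ≃g Δ.graph, ∀ e : Γ.graph.edgeSet, Δ.sign (φ.mapEdgeSet e) = Γ.sign e

/-- The disjoint union of a family of simple graphs. -/
def disjointUnionGraph {ι : Type*} {V : ι → Type*} (G : ∀ i, SimpleGraph (V i)) :
    SimpleGraph (Σ i, V i) where
  Adj x y := ∃ (i : ι) (a b : V i), (G i).Adj a b ∧ x = ⟨i, a⟩ ∧ y = ⟨i, b⟩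
  symm := ⟨by
    rintro x y ⟨i, a, b, h, rfl, rfl⟩
    exact ⟨i, b, a, h.symm, rfl, rfl⟩⟩
  loopless := ⟨by
    rintro x ⟨i, a, b, h, hx, hy⟩
    rw [hx] at hy
    cases hy
    exact h.ne rfl⟩

/-- Every edge of a disjoint union comes from an edge of one of the pieces. -/
theorem exists_edge_of_disjointUnionGraph {ι : Type*} {V : ι → Type*}
    (G : ∀ i, SimpleGraph (V i)) (e : (disjointUnionGraph G).edgeSet) :
    ∃ p : Σ i, (G i).edgeSet, Sym2.map (Sigma.mk p.1) p.2.1 = e.1 := by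
  obtain ⟨e, he⟩ := e
  induction e using Sym2.ind with
  | _ x y =>
    obtain ⟨i, a, b, h, hx, hy⟩ := id he
    refine ⟨⟨i, ⟨s(a, b), h⟩⟩, ?_⟩
    simp only [Sym2.map_mk]
    rw [← hx, ← hy]

/-- The disjoint union of a family of signed graphs: each edge keeps the sign that it has in the
piece it comes from. (That piece and that edge are unique, see `disjointUnion_sign`.) -/
noncomputable def disjointUnion {ι : Type*} {V : ι → Type*} (Γ : ∀ i, SignedGraph (V i)) :
    SignedGraph (Σ i, V i) where
  graph := disjointUnionGraph fun i => (Γ i).graph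
  sign e :=
    let p := (exists_edge_of_disjointUnionGraph (fun i => (Γ i).graph) e).choose
    (Γ p.1).sign p.2

theorem disjointUnion_adj {ι : Type*} {V : ι → Type*} (Γ : ∀ i, SignedGraph (V i)) {i : ι}
    {a b : V i} : (disjointUnion Γ).graph.Adj ⟨i, a⟩ ⟨i, b⟩ ↔ (Γ i).graph.Adj a b := by
  constructor
  · rintro ⟨j, c, d, h, h1, h2⟩
    cases h1
    cases h2
    exact h
  · intro h
    exact ⟨i, a, b, h, rfl, rfl⟩

theorem disjointUnion_sign {ι : Type*} {V : ι → Type*} (Γ : ∀ i, SignedGraph (V i)) {i : ι}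
    {a b : V i} (h : (Γ i).graph.Adj a b) :
    (disjointUnion Γ).sign ⟨s(⟨i, a⟩, ⟨i, b⟩), (disjointUnion_adj Γ).2 h⟩ =
      (Γ i).sign ⟨s(a, b), h⟩ := by
  have key : ∀ p : Σ j, (Γ j).graph.edgeSet,
      Sym2.map (Sigma.mk p.1) p.2.1 = s((⟨i, a⟩ : Σ j, V j), ⟨i, b⟩) →
        (Γ p.1).sign p.2 = (Γ i).sign ⟨s(a, b), h⟩ := by
    rintro ⟨j, ⟨e, he⟩⟩ hp
    induction e using Sym2.ind with
    | _ c d =>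
      simp only [Sym2.map_mk] at hp
      rcases Sym2.eq_iff.1 hp with ⟨h1, h2⟩ | ⟨h1, h2⟩
      · cases h1
        cases h2
        rfl
      · cases h1
        cases h2
        exact congrArg (Γ i).sign (Subtype.ext Sym2.eq_swap)
  exact key _ (exists_edge_of_disjointUnionGraph (fun j => (Γ j).graph) _).choose_spec

end SignedGraph

/-! Let `excess` be 2i₊ + 2c + Σ `degreeWeight` (deg v). Without isolated vertices the sum of
weights is 2|E| − 3n + p, so the equality in question says exactly that the excess vanishes. The
excess is additive over components. It therefore suffices to show that a connected graph has
nonnegative excess, that with at least two vertices it is a cycle when the excess is zero, and to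
decide which signed cycles have excess zero.

The connected bound is `Linked.exists_hasPosSubspace`, an induction on vertex subsets that builds
positive definite subspaces. A subspace survives the return of a deleted vertex, and a pendant
vertex together with its neighbour yields one more dimension (`HasPosSubspace.add_pendant`). Signs
play no role here: only the position of the nonzero entries matters. The induction also carries
strictness as soon as some degree differs from two; the remaining connected 2-regular graphs are
cycles (`exists_iso_cycleGraph`).

A signed cycle of length n has excess 2i₊ + 2 − n, which is odd for odd n. For even n it is
bipartite, so its spectrum is symmetric and 2i₊ ≤ n; together with nonnegativity the excess is 0 or
2, and it is 0 exactly if the matrix is singular. Following a kernel vector around the cycle, this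
happens iff the product of the signs is (−1)^(n/2) (`cycle_det_eq_zero_iff`), which is the
congruence modulo 4. -/

/-! ### Positive definite subspaces with prescribed support. -/

/-- There is a `k`-dimensional space of vectors supported on `S` on which the quadratic form of `A`
is positive definite. -/
def HasPosSubspace {V : Type*} [Fintype V] (A : Matrix V V ℝ) (S : Finset V) (k : ℕ) : Prop :=
  ∃ W : Submodule ℝ (V → ℝ), Module.finrank ℝ W = k ∧
    (∀ x ∈ W, x ≠ 0 → 0 < x ⬝ᵥ A.mulVec x) ∧ ∀ x ∈ W, ∀ v ∉ S, x v = 0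

namespace HasPosSubspace

variable {V : Type*} [Fintype V] {A : Matrix V V ℝ}

theorem zero (S : Finset V) : HasPosSubspace A S 0 :=
  ⟨⊥, by simp, fun x hx h => (h (by simpa using hx)).elim, fun x hx => by
    simp [(Submodule.mem_bot ℝ).1 hx]⟩

theorem mono {S T : Finset V} {k : ℕ} (h : HasPosSubspace A S k) (hST : S ⊆ T) :
    HasPosSubspace A T k := by
  obtain ⟨W, h1, h2, h3⟩ := h
  exact ⟨W, h1, h2, fun x hx v hv => h3 x hx v fun h => hv (hST h)⟩

theorem quadratic_two_coordinates [DecidableEq V] (hA : A.transpose = A) {u w : V}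
    (huu : A u u = 0) (hww : A w w = 0) (x : V → ℝ) (α β : ℝ) :
    (x + α • Pi.single u 1 + β • Pi.single w 1) ⬝ᵥ
        A.mulVec (x + α • Pi.single u 1 + β • Pi.single w 1) =
      x ⬝ᵥ A.mulVec x + 2 * α * (A.mulVec x u) + 2 * β * (A.mulVec x w) +
        2 * α * β * A u w := by
  have sym (i j : V) : A i j = A j i := congrFun (congrFun hA j) i
  have col (i : V) : x ⬝ᵥ A.col i = A.mulVec x i := by
    rw [dotProduct_comm]
    simp only [Matrix.mulVec, dotProduct, Matrix.col_apply]
    exact Finset.sum_congr rfl fun j _ => by rw [sym j i]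
  simp only [Matrix.mulVec_add, Matrix.mulVec_smul, Matrix.mulVec_single_one, dotProduct_add,
    add_dotProduct, smul_dotProduct, dotProduct_smul, single_one_dotProduct, smul_eq_mul,
    Matrix.col_apply, huu, hww, col, sym w u]
  ring

/-- Adding a vertex `u` whose only neighbour is `w`, together with `w` itself, increases the
positive index by one. -/
theorem add_pendant (hA : A.transpose = A) {S T : Finset V} {k : ℕ}
    {u w : V} (huu : A u u = 0) (hww : A w w = 0) (huw : A u w ≠ 0)
    (hu : u ∈ S) (hw : w ∈ S) (hTS : T ⊆ S)
    (hT : ∀ y ∈ T, A u y = 0) (h : HasPosSubspace A T k) : HasPosSubspace A S (k + 1) := by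
  classical
  obtain ⟨W, h1, h2, h3⟩ := h
  have hne : u ≠ w := fun h => huw (by rw [← h, huu])
  set s := A u w with hs
  let row : (V → ℝ) →ₗ[ℝ] ℝ := (LinearMap.proj w).comp A.mulVecLin
  -- The coefficient of e_u is chosen so that the cross term 2sc(Ax)_w cancels and the form becomes
  -- Q(x) + 2(sc)².
  let F : (W × ℝ) →ₗ[ℝ] (V → ℝ) :=
    W.subtype.comp (LinearMap.fst ℝ W ℝ) +
      (LinearMap.toSpanSingleton ℝ (V → ℝ) (Pi.single u 1)).comp
        (LinearMap.snd ℝ W ℝ - s⁻¹ • (row.comp (W.subtype.comp (LinearMap.fst ℝ W ℝ)))) +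
      (LinearMap.toSpanSingleton ℝ (V → ℝ) (Pi.single w 1)).comp
        (s • LinearMap.snd ℝ W ℝ)
  have hF (x : W) (c : ℝ) : F (x, c) = (x : V → ℝ) +
      (c - s⁻¹ * A.mulVec x w) • Pi.single u 1 + (s * c) • Pi.single w 1 := by
    simp [F, row]
  have hQ (x : W) (c : ℝ) : F (x, c) ⬝ᵥ A.mulVec (F (x, c)) =
      (x : V → ℝ) ⬝ᵥ A.mulVec x + 2 * (s * c) ^ 2 := by
    have hx0 : A.mulVec (x : V → ℝ) u = 0 := by
      simp only [Matrix.mulVec, dotProduct]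
      refine Finset.sum_eq_zero fun y _ => ?_
      by_cases hy : y ∈ T
      · rw [hT y hy, zero_mul]
      · rw [h3 x x.2 y hy, mul_zero]
    rw [hF, quadratic_two_coordinates hA huu hww, hx0, ← hs]
    field_simp
    ring
  have hpos (p : W × ℝ) (hp : p ≠ 0) : 0 < F p ⬝ᵥ A.mulVec (F p) := by
    obtain ⟨x, c⟩ := p
    rw [hQ]
    by_cases hx : x = 0
    · have hc : c ≠ 0 := fun hc => hp (by rw [hx, hc]; rfl)
      have : 0 < (s * c) ^ 2 := by positivity
      simp only [hx, ZeroMemClass.coe_zero, Matrix.mulVec_zero, dotProduct_zero]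
      linarith
    · have : 0 ≤ (s * c) ^ 2 := sq_nonneg _
      linarith [h2 x x.2 (by simpa using hx)]
  have hinj : Function.Injective F := by
    rw [injective_iff_map_eq_zero]
    intro p hp
    by_contra hne
    have := hpos p hne
    simp [hp] at this
  refine ⟨LinearMap.range F, ?_, ?_, ?_⟩
  · rw [LinearMap.finrank_range_of_inj hinj, Module.finrank_prod, h1, Module.finrank_self]
  · rintro _ ⟨p, rfl⟩ hp
    exact hpos p fun h => hp (by rw [h, map_zero])
  · rintro _ ⟨⟨x, c⟩, rfl⟩ v hv
    have hvu : v ≠ u := fun h => hv (h ▸ hu)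
    have hvw : v ≠ w := fun h => hv (h ▸ hw)
    rw [hF]
    simp [hvu, hvw, h3 x x.2 v fun h => hv (hTS h)]

/-- A positive definite subspace has dimension at most the number of positive eigenvalues. -/
theorem le_card_eigenvalues [DecidableEq V] (hA : A.IsHermitian) {S : Finset V} {k : ℕ}
    (h : HasPosSubspace A S k) :
    k ≤ (Finset.univ.filter fun i : V => 0 < hA.eigenvalues i).card := by
  obtain ⟨W, rfl, h2, -⟩ := h
  set U : Matrix V V ℝ := hA.eigenvectorUnitary.1
  have hUU : U * star U = 1 := Unitary.coe_mul_star_self hA.eigenvectorUnitary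
  have hinj : Function.Injective (star U).mulVecLin := by
    intro x y hxy
    simpa [Matrix.mulVec_mulVec, hUU] using congrArg U.mulVec hxy
  have hspec : A = U * Matrix.diagonal hA.eigenvalues * star U := by
    conv_lhs => rw [hA.spectral_theorem, Unitary.conjStarAlgAut_apply]
    rfl
  have hQ (x : V → ℝ) : x ⬝ᵥ A.mulVec x =
      QuadraticMap.weightedSumSquares ℝ hA.eigenvalues ((star U).mulVec x) := by
    conv_lhs => rw [hspec]
    rw [← Matrix.mulVec_mulVec, ← Matrix.mulVec_mulVec, Matrix.dotProduct_mulVec,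
      QuadraticMap.weightedSumSquares_apply]
    have : Matrix.vecMul x U = (star U).mulVec x := by
      rw [← Matrix.mulVec_transpose]; rfl
    rw [this]
    simp only [dotProduct, Matrix.mulVec_diagonal, smul_eq_mul]
    exact Finset.sum_congr rfl fun i _ => by ring
  -- Sylvester's law of inertia in the eigenbasis: the positive index of a weighted sum of squares
  -- is the number of positive weights.
  have := le_sigPos_of_posDef
    (QuadraticMap.weightedSumSquares ℝ hA.eigenvalues) (V := W.map (star U).mulVecLin) (by
      rintro ⟨_, x, hx, rfl⟩ hne
      simp only [QuadraticMap.restrict_apply, Matrix.mulVecLin_apply]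
      rw [← hQ]
      refine h2 x hx ?_
      rintro rfl
      exact hne (by ext; simp))
  rw [QuadraticForm.sigPos_weightedSumSquares,
    LinearEquiv.finrank_eq (Submodule.equivMapOfInjective _ hinj W).symm] at this
  refine this.trans_eq ?_
  rw [Set.ncard_eq_toFinset_card']
  congr 1
  ext; simp

end HasPosSubspace

/-! ### Degree weights and connectivity of induced subgraphs. -/

/-- The contribution of a vertex of degree `d` to the excess of a graph: `d - 3`, plus one if the
vertex is pendant or isolated. -/
def degreeWeight (d : ℕ) : ℤ := if d ≤ 1 then (d : ℤ) - 2 else d - 3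

theorem degreeWeight_succ (d : ℕ) :
    degreeWeight (d + 1) = degreeWeight d + if d + 1 ≠ 2 then 1 else 0 := by
  rcases d with _ | _ | d <;> simp [degreeWeight]
  ring

namespace SimpleGraph

variable {V : Type*} [DecidableEq V] (G : SimpleGraph V) [DecidableRel G.Adj]

/-- The number of neighbours of `v` in `S`. -/
def degreeIn (S : Finset V) (v : V) : ℕ := (S.filter fun y => G.Adj v y).card

/-- The sum of the degree weights of the subgraph induced by `S`. -/
def weightIn (S : Finset V) : ℤ := ∑ v ∈ S, degreeWeight (G.degreeIn S v)

/-- The subgraph induced by `S` is connected: a nonempty subset of `S` closed under adjacency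
within `S` is all of `S`. -/
def Linked (S : Finset V) : Prop :=
  S.Nonempty ∧ ∀ T ⊆ S, T.Nonempty → (∀ x ∈ T, ∀ y ∈ S, G.Adj x y → y ∈ T) → T = S

variable {G} {S : Finset V} {v x : V}

theorem degreeIn_erase_of_adj (hv : v ∈ S) (h : G.Adj x v) :
    G.degreeIn S x = G.degreeIn (S.erase v) x + 1 := by
  unfold degreeIn
  rw [Finset.filter_erase, Finset.card_erase_add_one]
  simp [hv, h]

theorem degreeIn_erase_of_not_adj (h : ¬ G.Adj x v) :
    G.degreeIn (S.erase v) x = G.degreeIn S x := by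
  unfold degreeIn
  rw [Finset.filter_erase, Finset.erase_eq_of_notMem]
  simp [h]

/-- Each neighbour of `v` loses one from its degree, hence one from its weight, except when its
degree drops from 2 to 1: both have weight −1. -/
theorem weightIn_erase (hv : v ∈ S) :
    G.weightIn S = G.weightIn (S.erase v) + degreeWeight (G.degreeIn S v) +
      ((S.filter fun x => G.Adj v x ∧ G.degreeIn S x ≠ 2).card : ℤ) := by
  have hself : S.filter (fun x => G.Adj v x ∧ G.degreeIn S x ≠ 2) =
      (S.erase v).filter (fun x => G.Adj v x ∧ G.degreeIn S x ≠ 2) := by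
    rw [Finset.filter_erase, Finset.erase_eq_of_notMem]
    simp
  unfold weightIn
  rw [hself, ← Finset.add_sum_erase S _ hv, Finset.card_filter]
  push_cast
  rw [add_comm (degreeWeight _), add_right_comm, ← Finset.sum_add_distrib]
  congr 1
  refine Finset.sum_congr rfl fun x _ => ?_
  by_cases h : G.Adj v x
  · rw [degreeIn_erase_of_adj hv h.symm, degreeWeight_succ]
    simp [h]
  · rw [degreeIn_erase_of_not_adj fun h' => h h'.symm]
    simp [h]

set_option linter.unusedSectionVars false

theorem exists_adj_of_degreeIn_pos (h : 0 < G.degreeIn S v) : ∃ x ∈ S, G.Adj v x := by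
  obtain ⟨x, hx⟩ := Finset.card_pos.1 h
  exact ⟨x, (Finset.mem_filter.1 hx).1, (Finset.mem_filter.1 hx).2⟩

theorem degreeIn_pos (hx : x ∈ S) (h : G.Adj v x) : 0 < G.degreeIn S v :=
  Finset.card_pos.2 ⟨x, Finset.mem_filter.2 ⟨hx, h⟩⟩

theorem eq_of_degreeIn_eq_one {y : V} (h : G.degreeIn S v = 1) (hx : x ∈ S) (hy : y ∈ S)
    (hvx : G.Adj v x) (hvy : G.Adj v y) : x = y :=
  Finset.card_le_one.1 h.le x (Finset.mem_filter.2 ⟨hx, hvx⟩) y (Finset.mem_filter.2 ⟨hy, hvy⟩)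

namespace Linked

theorem singleton (v : V) : G.Linked {v} :=
  ⟨Finset.singleton_nonempty v, fun _ hT hne _ => hne.subset_singleton_iff.1 hT⟩

theorem degreeIn_pos (h : G.Linked S) (hS : 2 ≤ S.card) (hv : v ∈ S) : 0 < G.degreeIn S v := by
  by_contra h0
  have := h.2 {v} (by simpa) (Finset.singleton_nonempty v) (by
    intro x hx y hy hxy
    rw [Finset.mem_singleton.1 hx] at hxy
    exact (h0 (SimpleGraph.degreeIn_pos hy hxy)).elim)
  rw [← this] at hS
  simp at hS

theorem insert (h : G.Linked S) (hx : x ∈ S) (hvx : G.Adj v x) : G.Linked (insert v S) := by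
  refine ⟨Finset.insert_nonempty v S, fun T hT hne hcl => ?_⟩
  have key : ∃ y ∈ T, y ∈ S := by
    obtain ⟨y, hy⟩ := hne
    rcases Finset.mem_insert.1 (hT hy) with rfl | h'
    · exact ⟨x, hcl y hy x (Finset.mem_insert_of_mem hx) hvx, hx⟩
    · exact ⟨y, hy, h'⟩
  obtain ⟨y, hyT, hyS⟩ := key
  have hTS := h.2 (T ∩ S) Finset.inter_subset_right ⟨y, by simp [hyT, hyS]⟩ (by
    intro a ha b hb hab
    exact Finset.mem_inter.2
      ⟨hcl a (Finset.mem_inter.1 ha).1 b (Finset.mem_insert_of_mem hb) hab, hb⟩)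
  have hST : S ⊆ T := Finset.inter_eq_right.1 hTS
  refine Finset.Subset.antisymm hT (Finset.insert_subset ?_ hST)
  exact hcl x (hST hx) v (Finset.mem_insert_self v S) hvx.symm

/-- A closed subset of S − v stays closed in S, after adding `v` if it contains the only neighbour
`w` of `v`. -/
theorem erase_of_degreeIn_eq_one (h : G.Linked S) (hv : v ∈ S) (h1 : G.degreeIn S v = 1) :
    G.Linked (S.erase v) := by
  obtain ⟨w, hw, hvw⟩ := exists_adj_of_degreeIn_pos (h1 ▸ Nat.one_pos : 0 < G.degreeIn S v)
  refine ⟨⟨w, Finset.mem_erase.2 ⟨hvw.ne', hw⟩⟩, fun T hT hne hcl => ?_⟩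
  have hTS : T ⊆ S := hT.trans (Finset.erase_subset v S)
  by_cases hwT : w ∈ T
  · have := h.2 (Insert.insert v T) (Finset.insert_subset hv hTS) (Finset.insert_nonempty v T) (by
      intro x hx y hy hxy
      rcases Finset.mem_insert.1 hx with rfl | hx
      · rw [eq_of_degreeIn_eq_one h1 hy hw hxy hvw]
        exact Finset.mem_insert_of_mem hwT
      · by_cases hyv : y = v
        · exact hyv ▸ Finset.mem_insert_self v T
        · exact Finset.mem_insert_of_mem (hcl x hx y (Finset.mem_erase.2 ⟨hyv, hy⟩) hxy))
    rw [← this, Finset.erase_insert fun hv => Finset.notMem_erase v S (hT hv)]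
  · have := h.2 T hTS hne (by
      intro x hx y hy hxy
      by_cases hyv : y = v
      · subst hyv
        exact (hwT (eq_of_degreeIn_eq_one h1 (hTS hx) hw hxy.symm hvw ▸ hx)).elim
      · exact hcl x hx y (Finset.mem_erase.2 ⟨hyv, hy⟩) hxy)
    exact (Finset.notMem_erase v S (hT (this ▸ hv))).elim

theorem exists_erase (h : G.Linked S) (hS : 2 ≤ S.card) : ∃ v ∈ S, G.Linked (S.erase v) := by
  classical
  obtain ⟨s, hs⟩ := h.1
  -- A connected proper subset of maximal size has a neighbour `y` outside; adding `y` keeps it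
  -- connected, so it misses only `y`.
  obtain ⟨T, hT, hmax⟩ := Finset.exists_max_image
    (S.powerset.filter fun T => G.Linked T ∧ T ≠ S) Finset.card
    ⟨{s}, by
      simp only [Finset.mem_filter, Finset.mem_powerset, Finset.singleton_subset_iff]
      refine ⟨hs, singleton s, ?_⟩
      rintro rfl
      simp at hS⟩
  simp only [Finset.mem_filter, Finset.mem_powerset] at hT hmax
  obtain ⟨hTS, hT, hne⟩ := hT
  have : ∃ x ∈ T, ∃ y ∈ S, G.Adj x y ∧ y ∉ T := by
    by_contra! hcl
    exact hne (h.2 T hTS hT.1 hcl)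
  obtain ⟨x, hx, y, hy, hxy, hyT⟩ := this
  have hins := hT.insert hx hxy.symm
  have hS' : Insert.insert y T = S := by
    by_contra hne'
    have := hmax _ ⟨Finset.insert_subset hy hTS, hins, hne'⟩
    rw [Finset.card_insert_of_notMem hyT] at this
    omega
  exact ⟨y, hy, by rw [← hS', Finset.erase_insert hyT]; exact hT⟩

/-- If `v` is not a cut vertex, then neither is a neighbour of `v`, when both have degree two. -/
theorem erase_of_adj (h : G.Linked (S.erase v)) (hv : v ∈ S) (hv2 : G.degreeIn S v = 2)
    (hx : x ∈ S) (hvx : G.Adj v x) (hx2 : G.degreeIn S x = 2) : G.Linked (S.erase x) := by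
  have h1 : G.degreeIn (S.erase v) x = 1 := by
    have := degreeIn_erase_of_adj hv hvx.symm
    omega
  have h2 : G.degreeIn (S.erase x) v = 1 := by
    have := degreeIn_erase_of_adj hx hvx
    omega
  obtain ⟨y, hy, hvy⟩ := exists_adj_of_degreeIn_pos (h2 ▸ Nat.one_pos : 0 < G.degreeIn _ v)
  -- In S − v the vertex `x` is a leaf and can be removed; then `v` is reattached through its other
  -- neighbour `y`.
  have := (h.erase_of_degreeIn_eq_one (Finset.mem_erase.2 ⟨hvx.ne', hx⟩) h1).insert (v := v)
    (x := y) (by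
      simp only [Finset.mem_erase] at hy ⊢
      exact ⟨hy.1, hvy.ne', hy.2⟩) hvy
  rwa [Finset.erase_right_comm, Finset.insert_erase (Finset.mem_erase.2 ⟨hvx.ne, hv⟩)] at this

/-- Under `H` the set of non-cut vertices is closed under adjacency by `erase_of_adj`, and it is
nonempty, so it is all of S. -/
theorem forall_degreeIn_eq_two (h : G.Linked S) (hS : 2 ≤ S.card)
    (H : ∀ v ∈ S, G.Linked (S.erase v) →
      G.degreeIn S v = 2 ∧ ∀ x ∈ S, G.Adj v x → G.degreeIn S x = 2) :
    ∀ v ∈ S, G.degreeIn S v = 2 ∧ G.Linked (S.erase v) := by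
  classical
  obtain ⟨v, hv, hvl⟩ := h.exists_erase hS
  have := h.2 (S.filter fun v => G.Linked (S.erase v)) (Finset.filter_subset _ _)
    ⟨v, Finset.mem_filter.2 ⟨hv, hvl⟩⟩ (by
      intro x hx y hy hxy
      obtain ⟨hx, hxl⟩ := Finset.mem_filter.1 hx
      obtain ⟨hx2, hxn⟩ := H x hx hxl
      exact Finset.mem_filter.2 ⟨hy, hxl.erase_of_adj hx hx2 hy hxy (hxn y hy hxy)⟩)
  intro w hw
  have hwl := (Finset.mem_filter.1 (this.symm ▸ hw)).2
  exact ⟨(H w hw hwl).1, hwl⟩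

theorem erase_of_forall_degreeIn_eq_two (h : G.Linked S) (hS : 2 ≤ S.card)
    (h2 : ∀ v ∈ S, G.degreeIn S v = 2) (hv : v ∈ S) : G.Linked (S.erase v) :=
  (h.forall_degreeIn_eq_two hS (fun v hv _ => ⟨h2 v hv, fun x hx _ => h2 x hx⟩) v hv).2

end Linked

end SimpleGraph

/-! ### The lower bound for connected graphs. -/

namespace SimpleGraph

variable {V : Type*} [DecidableEq V] {G : SimpleGraph V} [DecidableRel G.Adj]
  {S : Finset V} {v x : V}

set_option linter.unusedSectionVars false

theorem two_le_card_of_adj (hv : v ∈ S) (hx : x ∈ S) (h : G.Adj v x) : 2 ≤ S.card :=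
  Finset.one_lt_card.2 ⟨v, hv, x, hx, h.ne⟩

theorem two_le_card_of_degreeIn_pos (hv : v ∈ S) (h : 0 < G.degreeIn S v) : 2 ≤ S.card := by
  obtain ⟨x, hx, hvx⟩ := exists_adj_of_degreeIn_pos h
  exact two_le_card_of_adj hv hx hvx

theorem neg_card_le_weightIn (h : ∀ v ∈ S, 0 < G.degreeIn S v) :
    -(S.card : ℤ) ≤ G.weightIn S := by
  have := Finset.card_nsmul_le_sum S (fun v => degreeWeight (G.degreeIn S v)) (-1) (by
    intro v hv
    have := h v hv
    simp only [degreeWeight]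
    split_ifs <;> omega)
  simpa [weightIn] using this

variable [Fintype V] {A : Matrix V V ℝ}

theorem hasPosSubspace_add_pendant (hA : A.transpose = A) (hG : ∀ u v, G.Adj u v ↔ A u v ≠ 0)
    {u w : V} (hu : u ∈ S) (hw : w ∈ S) (huw : G.Adj u w) (h1 : G.degreeIn S u = 1) {k : ℕ}
    (h : HasPosSubspace A ((S.erase u).erase w) k) : HasPosSubspace A S (k + 1) := by
  have diag (x : V) : A x x = 0 := by
    by_contra hx
    exact G.loopless.irrefl x ((hG x x).2 hx)
  refine HasPosSubspace.add_pendant hA (diag u) (diag w) ((hG u w).1 huw) hu hw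
    ((Finset.erase_subset _ _).trans (Finset.erase_subset _ _)) (fun y hy => ?_) h
  by_contra hy0
  simp only [Finset.mem_erase] at hy
  exact hy.1 (eq_of_degreeIn_eq_one h1 hy.2.2 hw ((hG u y).2 hy0) huw)

/-- A connected induced subgraph carries a positive definite subspace whose dimension is bounded
below in terms of the degrees, the bound being strict unless the subgraph is regular of degree two
or a single vertex. -/
theorem Linked.exists_hasPosSubspace (hA : A.transpose = A)
    (hG : ∀ u v, G.Adj u v ↔ A u v ≠ 0) (S : Finset V) (hS : G.Linked S) :
    ∃ k, HasPosSubspace A S k ∧ 0 ≤ 2 * (k : ℤ) + 2 + G.weightIn S ∧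
      (2 ≤ S.card → (∃ v ∈ S, G.degreeIn S v ≠ 2) → 0 < 2 * (k : ℤ) + 2 + G.weightIn S) := by
  induction S using Finset.strongInduction with
  | H S ih =>
  rcases lt_or_ge S.card 2 with hcard | hcard
  · refine ⟨0, HasPosSubspace.zero S, ?_, fun h => by omega⟩
    have h1 : S.card = 1 := by have := hS.1.card_pos; omega
    obtain ⟨v, rfl⟩ := Finset.card_eq_one.1 h1
    simp only [weightIn, Finset.sum_singleton, degreeWeight]
    split_ifs <;> omega
  have hpos : ∀ v ∈ S, 0 < G.degreeIn S v := fun v hv => hS.degreeIn_pos hcard hv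
  by_cases hpend : ∃ u ∈ S, G.degreeIn S u = 1
  · obtain ⟨u, hu, hu1⟩ := hpend
    obtain ⟨w, hw, huw⟩ := exists_adj_of_degreeIn_pos (hpos u hu)
    have hl := hS.erase_of_degreeIn_eq_one hu hu1
    have hwu : w ∈ S.erase u := Finset.mem_erase.2 ⟨huw.ne', hw⟩
    have hwt := weightIn_erase (G := G) hu
    rw [hu1] at hwt
    have hdw := degreeIn_erase_of_adj hu huw.symm
    have hw1 : degreeWeight 1 = -1 := rfl
    have hw2 : degreeWeight 2 = -1 := rfl
    -- If `w` has degree two, both `u` and `w` are removed: their weights −1 − 1 are paid for by the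
    -- extra dimension.
    by_cases hw2' : G.degreeIn S w = 2
    · have hl2 := hl.erase_of_degreeIn_eq_one hwu (by omega)
      obtain ⟨k, hk, hk0, hks⟩ := ih _
        ((Finset.erase_ssubset hwu).trans (Finset.erase_ssubset hu)) hl2
      have hwt2 := weightIn_erase (G := G) hwu
      rw [show G.degreeIn (S.erase u) w = 1 by omega] at hwt2
      refine ⟨k + 1, hasPosSubspace_add_pendant hA hG hu hw huw hu1 hk, ?_, fun _ _ => ?_⟩
      · push_cast; omega
      · obtain ⟨x, hx, hwx⟩ := exists_adj_of_degreeIn_pos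
          (by omega : 0 < G.degreeIn (S.erase u) w)
        by_cases hx2 : G.degreeIn (S.erase u) x = 2
        · have hdx := degreeIn_erase_of_adj hwu hwx.symm
          rw [hx2] at hdx
          have hxm : x ∈ (S.erase u).erase w := Finset.mem_erase.2 ⟨hwx.ne', hx⟩
          have hx1 : G.degreeIn _ x = 1 := Nat.succ_injective hdx.symm
          have := hks (two_le_card_of_degreeIn_pos (G := G) hxm (by omega)) ⟨x, hxm, by omega⟩
          push_cast; omega
        · have : 0 < ((S.erase u).filter fun x =>
              G.Adj w x ∧ G.degreeIn (S.erase u) x ≠ 2).card :=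
            Finset.card_pos.2 ⟨x, Finset.mem_filter.2 ⟨hx, hwx, hx2⟩⟩
          push_cast; omega
    -- Otherwise removing `u` costs nothing: its weight −1 is offset by the loss at `w`.
    · have ha : 0 < (S.filter fun x => G.Adj u x ∧ G.degreeIn S x ≠ 2).card :=
        Finset.card_pos.2 ⟨w, Finset.mem_filter.2 ⟨hw, huw, hw2'⟩⟩
      have hcard' := Finset.card_erase_add_one hu
      rcases lt_or_ge (S.erase u).card 2 with hc | hc
      · have := neg_card_le_weightIn hpos
        refine ⟨1, hasPosSubspace_add_pendant hA hG hu hw huw hu1 (.zero _), ?_, fun _ _ => ?_⟩ <;>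
        · push_cast; omega
      -- A 2-regular S − u gives no strict inequality by induction. Then `w` is removed too, which
      -- leaves a vertex of degree one.
      by_cases hreg : ∀ v ∈ S.erase u, G.degreeIn (S.erase u) v = 2
      · have hl2 := hl.erase_of_forall_degreeIn_eq_two hc hreg hwu
        obtain ⟨k, hk, -, hks⟩ := ih _
          ((Finset.erase_ssubset hwu).trans (Finset.erase_ssubset hu)) hl2
        have hwt2 := weightIn_erase (G := G) hwu
        have hemp : ((S.erase u).filter fun x =>
            G.Adj w x ∧ G.degreeIn (S.erase u) x ≠ 2).card = 0 := by
          rw [Finset.card_eq_zero, Finset.filter_eq_empty_iff]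
          exact fun x hx h => h.2 (hreg x hx)
        rw [hreg w hwu, hemp] at hwt2
        obtain ⟨x, hx, hwx⟩ := exists_adj_of_degreeIn_pos (hl.degreeIn_pos hc hwu)
        have hdx := degreeIn_erase_of_adj hwu hwx.symm
        rw [hreg x hx] at hdx
        have hxm : x ∈ (S.erase u).erase w := Finset.mem_erase.2 ⟨hwx.ne', hx⟩
        have hx1 : G.degreeIn _ x = 1 := Nat.succ_injective hdx.symm
        have := hks (two_le_card_of_degreeIn_pos (G := G) hxm (by omega)) ⟨x, hxm, by omega⟩
        refine ⟨k + 1, hasPosSubspace_add_pendant hA hG hu hw huw hu1 hk, ?_, fun _ _ => ?_⟩ <;>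
        · push_cast at *; omega
      · obtain ⟨k, hk, hk0, hks⟩ := ih _ (Finset.erase_ssubset hu) hl
        push Not at hreg
        have := hks hc hreg
        exact ⟨k, hk.mono (Finset.erase_subset u S), by omega, fun _ _ => by omega⟩
  push Not at hpend
  -- With all degrees at least two, `H` forces S to be 2-regular. Removing a vertex then costs one
  -- unit of weight, which the strict inequality for the remainder covers.
  by_cases H : ∀ v ∈ S, G.Linked (S.erase v) →
      G.degreeIn S v = 2 ∧ ∀ x ∈ S, G.Adj v x → G.degreeIn S x = 2
  · have hreg := hS.forall_degreeIn_eq_two hcard H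
    obtain ⟨v, hv⟩ := hS.1
    obtain ⟨k, hk, hk0, hks⟩ := ih _ (Finset.erase_ssubset hv) (hreg v hv).2
    obtain ⟨x, hx, hvx⟩ := exists_adj_of_degreeIn_pos (hpos v hv)
    have hdx := degreeIn_erase_of_adj hv hvx.symm
    rw [(hreg x hx).1] at hdx
    have hxm : x ∈ S.erase v := Finset.mem_erase.2 ⟨hvx.ne', hx⟩
    have hx1 : G.degreeIn _ x = 1 := Nat.succ_injective hdx.symm
    have := hks (two_le_card_of_degreeIn_pos (G := G) hxm (by omega)) ⟨x, hxm, by omega⟩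
    have hwt := weightIn_erase (G := G) hv
    rw [(hreg v hv).1, show degreeWeight 2 = -1 from rfl] at hwt
    refine ⟨k, hk.mono (Finset.erase_subset v S), by omega, fun _ ⟨y, hy, hy2⟩ => ?_⟩
    exact (hy2 (hreg y hy).1).elim
  · push Not at H
    obtain ⟨v, hv, hl, hvd⟩ := H
    have hv2 : 2 ≤ G.degreeIn S v := by
      have := hpos v hv
      have := hpend v hv
      omega
    obtain ⟨k, hk, hk0, hks⟩ := ih _ (Finset.erase_ssubset hv) hl
    have hwt := weightIn_erase (G := G) hv
    have hdw : degreeWeight (G.degreeIn S v) = G.degreeIn S v - 3 := by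
      simp only [degreeWeight]
      split_ifs <;> omega
    have h3 : 3 ≤ G.degreeIn S v +
        (S.filter fun x => G.Adj v x ∧ G.degreeIn S x ≠ 2).card := by
      by_cases h2 : G.degreeIn S v = 2
      · obtain ⟨x, hx, hvx, hx2⟩ := hvd h2
        have : 0 < (S.filter fun x => G.Adj v x ∧ G.degreeIn S x ≠ 2).card :=
          Finset.card_pos.2 ⟨x, Finset.mem_filter.2 ⟨hx, hvx, hx2⟩⟩
        omega
      · omega
    refine ⟨k, hk.mono (Finset.erase_subset v S), by omega, fun _ _ => ?_⟩
    -- If S − v is 2-regular, all d neighbours of `v` have degree three in S, so the weight grows by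
    -- (d − 3) + d > 0.
    by_cases hreg : ∀ x ∈ S.erase v, G.degreeIn (S.erase v) x = 2
    · have : (S.filter fun x => G.Adj v x ∧ G.degreeIn S x ≠ 2) = S.filter fun x => G.Adj v x := by
        refine Finset.filter_congr fun x hx => ⟨fun h => h.1, fun h => ⟨h, ?_⟩⟩
        have := degreeIn_erase_of_adj hv h.symm
        have := hreg x (Finset.mem_erase.2 ⟨h.ne', hx⟩)
        omega
      rw [this] at hwt
      change G.weightIn S = _ + _ + (G.degreeIn S v : ℤ) at hwt
      omega
    · push Not at hreg
      have hc : 2 ≤ (S.erase v).card := by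
        refine hv2.trans (Finset.card_le_card fun x hx => ?_)
        obtain ⟨hx, hvx⟩ := Finset.mem_filter.1 hx
        exact Finset.mem_erase.2 ⟨hvx.ne', hx⟩
      have := hks hc hreg
      omega

end SimpleGraph

/-! ### Isomorphism invariance of the excess, and its relation to the inertia equality. -/

namespace SignedGraph

section Isomorphism

variable {V W : Type*} (Γ : SignedGraph V) (Δ : SignedGraph W)

theorem adjMatrix_of_adj {u v : V} (h : Γ.graph.Adj u v) :
    Γ.adjMatrix u v = ((Γ.sign ⟨s(u, v), h⟩ : ℤ) : ℝ) := by
  simp [adjMatrix, h]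

theorem adjMatrix_of_not_adj {u v : V} (h : ¬ Γ.graph.Adj u v) : Γ.adjMatrix u v = 0 := by
  simp [adjMatrix, h]

theorem adj_iff_adjMatrix_ne_zero (u v : V) : Γ.graph.Adj u v ↔ Γ.adjMatrix u v ≠ 0 := by
  by_cases h : Γ.graph.Adj u v
  · simp [adjMatrix_of_adj, h]
  · simp [adjMatrix_of_not_adj, h]

theorem adjMatrix_transpose : Γ.adjMatrix.transpose = Γ.adjMatrix := by
  simpa [Matrix.IsHermitian, Matrix.conjTranspose_eq_transpose_of_trivial]
    using Γ.adjMatrix_isHermitian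

variable {Γ Δ}

theorem isomorphic_iff :
    Γ.Isomorphic Δ ↔ ∃ e : V ≃ W, ∀ u v, Δ.adjMatrix (e u) (e v) = Γ.adjMatrix u v := by
  constructor
  · rintro ⟨φ, hφ⟩
    refine ⟨φ.toEquiv, fun u v => ?_⟩
    by_cases h : Γ.graph.Adj u v
    · have h' : Δ.graph.Adj (φ u) (φ v) := φ.map_adj_iff.2 h
      change Δ.adjMatrix (φ u) (φ v) = _
      rw [adjMatrix_of_adj _ h, adjMatrix_of_adj _ h', ← hφ]
      rfl
    · have h' : ¬ Δ.graph.Adj (φ u) (φ v) := fun h' => h (φ.map_adj_iff.1 h')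
      change Δ.adjMatrix (φ u) (φ v) = _
      rw [adjMatrix_of_not_adj _ h, adjMatrix_of_not_adj _ h']
  · rintro ⟨e, he⟩
    refine ⟨⟨e, ?_⟩, ?_⟩
    · intro u v
      rw [adj_iff_adjMatrix_ne_zero, adj_iff_adjMatrix_ne_zero, he]
    · rintro ⟨x, hx⟩
      induction x using Sym2.ind with
      | _ u v =>
        have h' : Δ.graph.Adj (e u) (e v) := by
          rw [adj_iff_adjMatrix_ne_zero, he, ← adj_iff_adjMatrix_ne_zero]
          exact hx
        have := he u v
        rw [adjMatrix_of_adj _ hx, adjMatrix_of_adj _ h'] at this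
        exact Units.ext (Int.cast_injective this)

theorem Isomorphic.trans {U : Type*} {Λ : SignedGraph U} (h : Γ.Isomorphic Δ)
    (h' : Δ.Isomorphic Λ) : Γ.Isomorphic Λ := by
  rw [isomorphic_iff] at *
  obtain ⟨e, he⟩ := h
  obtain ⟨e', he'⟩ := h'
  exact ⟨e.trans e', fun u v => (he' _ _).trans (he u v)⟩

end Isomorphism

section Excess

variable {V W : Type*} [Fintype V] [Fintype W]

/-- Twice the difference of the two sides of the inertia bound, for a signed graph without isolated
vertices. -/
noncomputable def excess (Γ : SignedGraph V) : ℤ :=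
  2 * Γ.posInertia + 2 * Nat.card Γ.graph.ConnectedComponent +
    ∑ v, degreeWeight (Γ.graph.neighborSet v).ncard

-- The characteristic polynomial is unchanged by relabelling vertices and factors over blocks, which
-- the indexed eigenvalues do not show.
open scoped Classical in
theorem posInertia_eq_card_roots [DecidableEq V] (Γ : SignedGraph V) :
    Γ.posInertia = (Γ.adjMatrix.charpoly.roots.filter fun x => 0 < x).card := by
  have := Γ.adjMatrix_isHermitian.roots_charpoly_eq_eigenvalues
  rw [posInertia]
  convert (congrArg (fun s => (Multiset.filter (fun x : ℝ => 0 < x) s).card) this).symm using 1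
  · simp only [Multiset.filter_map, Multiset.card_map]
    rfl

set_option linter.unusedSectionVars false

theorem ncard_neighborSet_iso {G : SimpleGraph V} {H : SimpleGraph W} (φ : G ≃g H) (v : V) :
    (H.neighborSet (φ v)).ncard = (G.neighborSet v).ncard :=
  (Nat.card_congr (φ.mapNeighborSet v)).symm

theorem Isomorphic.excess_eq {Γ : SignedGraph V} {Δ : SignedGraph W} (h : Γ.Isomorphic Δ) :
    Γ.excess = Δ.excess := by
  classical
  have hp : Γ.posInertia = Δ.posInertia := by
    obtain ⟨e, he⟩ := isomorphic_iff.1 h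
    rw [posInertia_eq_card_roots, posInertia_eq_card_roots,
      ← Matrix.charpoly_reindex e.symm Δ.adjMatrix]
    congr 4
    ext u v
    simp [he]
  obtain ⟨φ, -⟩ := h
  rw [excess, excess, hp, Nat.card_congr φ.connectedComponentEquiv,
    ← Equiv.sum_comp φ.toEquiv]
  congr 1
  exact Finset.sum_congr rfl fun v _ => by rw [← ncard_neighborSet_iso φ v]; rfl

theorem linked_univ_of_connected {G : SimpleGraph V} (h : G.Connected) : G.Linked Finset.univ := by
  refine ⟨Finset.univ_nonempty_iff.2 h.nonempty, fun T _ ⟨x, hx⟩ hcl => ?_⟩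
  refine Finset.eq_univ_of_forall fun y => ?_
  obtain ⟨w⟩ := h.preconnected x y
  induction w with
  | nil => exact hx
  | cons hadj _ ih => exact ih (hcl _ hx _ (Finset.mem_univ _) hadj)

theorem card_connectedComponent_of_connected {G : SimpleGraph V} (h : G.Connected) :
    Nat.card G.ConnectedComponent = 1 := by
  have := h.nonempty
  have := h.preconnected.subsingleton_connectedComponent
  exact Nat.card_unique

theorem excess_of_connected (Γ : SignedGraph V) (h : Γ.graph.Connected) :
    0 ≤ Γ.excess ∧ (Γ.excess = 0 → 2 ≤ Fintype.card V →
      ∀ v, (Γ.graph.neighborSet v).ncard = 2) := by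
  classical
  have hdeg (v : V) : Γ.graph.degreeIn Finset.univ v = (Γ.graph.neighborSet v).ncard := by
    rw [SimpleGraph.degreeIn, ← Set.ncard_coe_finset]
    congr 1
    ext; simp
  obtain ⟨k, hk, h0, hs⟩ := (linked_univ_of_connected h).exists_hasPosSubspace
    Γ.adjMatrix_transpose Γ.adj_iff_adjMatrix_ne_zero
  have hle : k ≤ Γ.posInertia := by
    convert hk.le_card_eigenvalues Γ.adjMatrix_isHermitian
    rw [posInertia]
  simp only [SimpleGraph.weightIn, hdeg, Finset.card_univ] at h0 hs
  rw [excess, card_connectedComponent_of_connected h]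
  push_cast
  refine ⟨by omega, fun he hc => ?_⟩
  by_contra! hne
  obtain ⟨v, hv⟩ := hne
  have := hs hc ⟨v, Finset.mem_univ v, hv⟩
  omega

open scoped Classical in
theorem posInertia_eq_iff_excess_eq_zero (Γ : SignedGraph V)
    (hΓ : ∀ c : Γ.graph.ConnectedComponent, 2 ≤ c.supp.ncard) :
    (Γ.posInertia : ℝ) =
        ((Fintype.card V : ℝ) - (Γ.pendantCount : ℝ)) / 2 - (Γ.cyclomaticNumber : ℝ) ↔
      Γ.excess = 0 := by
  have hdeg (v : V) : (Γ.graph.neighborSet v).ncard = Γ.graph.degree v := by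
    rw [← SimpleGraph.card_neighborSet_eq_degree, ← Nat.card_eq_fintype_card]
    rfl
  have hpos (v : V) : 0 < Γ.graph.degree v := by
    have h2 := hΓ (Γ.graph.connectedComponentMk v)
    obtain ⟨x, hx, hne⟩ := Set.exists_ne_of_one_lt_ncard (by omega :
      1 < (Γ.graph.connectedComponentMk v).supp.ncard) v
    obtain ⟨w⟩ : Γ.graph.Reachable v x := (SimpleGraph.ConnectedComponent.exact hx).symm
    cases w with
    | nil => exact (hne rfl).elim
    | cons h _ =>
      rw [SimpleGraph.degree_pos_iff_exists_adj]
      exact ⟨_, h⟩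
  have hsum : ∑ v, degreeWeight (Γ.graph.neighborSet v).ncard =
      2 * (Nat.card Γ.graph.edgeSet : ℤ) - 3 * Fintype.card V + Γ.pendantCount := by
    have hE : Nat.card Γ.graph.edgeSet = Γ.graph.edgeFinset.card := by
      rw [Nat.card_eq_fintype_card, SimpleGraph.edgeFinset_card]
    have := Γ.graph.sum_degrees_eq_twice_card_edges
    rw [hE, pendantCount, Finset.card_filter]
    have h2 : (2 * (Γ.graph.edgeFinset.card : ℤ)) = ∑ v, (Γ.graph.degree v : ℤ) := by
      exact_mod_cast this.symm
    rw [h2]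
    have h3 : (3 * (Fintype.card V : ℤ)) = ∑ v : V, 3 := by simp [mul_comm]
    rw [h3]
    push_cast
    rw [← Finset.sum_sub_distrib, ← Finset.sum_add_distrib]
    refine Finset.sum_congr rfl fun v _ => ?_
    have := hpos v
    rw [hdeg, degreeWeight]
    split_ifs <;> omega
  rw [excess, hsum, cyclomaticNumber, Nat.card_eq_fintype_card (α := V)]
  rw [← @Int.cast_inj ℝ]
  push_cast
  constructor <;> intro h <;> linarith

end Excess

/-! ### Additivity of the excess over disjoint unions. -/

section DisjointUnion

variable {t : ℕ} {V : Fin t → Type*}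

theorem adjMatrix_disjointUnion_same (C : ∀ i, SignedGraph (V i)) (i : Fin t) (a b : V i) :
    (disjointUnion C).adjMatrix ⟨i, a⟩ ⟨i, b⟩ = (C i).adjMatrix a b := by
  by_cases h : (C i).graph.Adj a b
  · rw [adjMatrix_of_adj _ h, adjMatrix_of_adj _ ((disjointUnion_adj C).2 h),
      disjointUnion_sign C h]
  · rw [adjMatrix_of_not_adj _ h, adjMatrix_of_not_adj _ fun h' => h ((disjointUnion_adj C).1 h')]

theorem disjointUnion_fst_eq_of_adj (C : ∀ i, SignedGraph (V i)) {x y : Σ i, V i}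
    (h : (disjointUnion C).graph.Adj x y) : x.1 = y.1 := by
  obtain ⟨i, a, b, -, rfl, rfl⟩ := h
  rfl

theorem adjMatrix_disjointUnion_of_ne (C : ∀ i, SignedGraph (V i)) {x y : Σ i, V i}
    (h : x.1 ≠ y.1) : (disjointUnion C).adjMatrix x y = 0 :=
  adjMatrix_of_not_adj _ fun h' => h (disjointUnion_fst_eq_of_adj C h')

theorem disjointUnion_isomorphic {W : Fin t → Type*} {C : ∀ i, SignedGraph (V i)}
    {D : ∀ i, SignedGraph (W i)} (h : ∀ i, (C i).Isomorphic (D i)) :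
    (disjointUnion C).Isomorphic (disjointUnion D) := by
  simp only [isomorphic_iff] at *
  choose e he using h
  refine ⟨Equiv.sigmaCongrRight e, ?_⟩
  rintro ⟨i, a⟩ ⟨j, b⟩
  by_cases hij : i = j
  · subst hij
    simp [adjMatrix_disjointUnion_same, he]
  · rw [adjMatrix_disjointUnion_of_ne _ hij, adjMatrix_disjointUnion_of_ne]
    simpa using hij

variable [∀ i, Fintype (V i)]

set_option linter.unusedSectionVars false

/-- The matrix is block diagonal, so its characteristic polynomial is the product over the blocks.
Nonempty pieces ensure that every index labels a block. -/
theorem posInertia_disjointUnion [∀ i, Nonempty (V i)] (C : ∀ i, SignedGraph (V i)) :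
    (disjointUnion C).posInertia = ∑ i, (C i).posInertia := by
  classical
  have htri : (disjointUnion C).adjMatrix.BlockTriangular Sigma.fst :=
    fun x y h => adjMatrix_disjointUnion_of_ne C h.ne'
  have himg : Finset.univ.image (Sigma.fst : (Σ i, V i) → Fin t) = Finset.univ :=
    Finset.image_univ_of_surjective fun i => ⟨⟨i, Classical.arbitrary _⟩, rfl⟩
  have hblock (i : Fin t) : ((disjointUnion C).adjMatrix.toSquareBlock Sigma.fst i).charpoly =
      (C i).adjMatrix.charpoly := by
    rw [← Matrix.charpoly_reindex (Equiv.sigmaSubtype i)]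
    congr 1
    ext a b
    exact adjMatrix_disjointUnion_same C i a b
  rw [posInertia_eq_card_roots, htri.charpoly, himg, Polynomial.roots_prod]
  · simp only [Multiset.bind, hblock]
    simp_rw [posInertia_eq_card_roots]
    induction (Finset.univ : Finset (Fin t)) using Finset.induction_on with
    | empty => simp
    | insert a s ha ih => simp_all [Finset.sum_insert]
  · exact Finset.prod_ne_zero_iff.2 fun i _ => (Matrix.charpoly_monic _).ne_zero

theorem card_connectedComponent_disjointUnion (C : ∀ i, SignedGraph (V i))
    (h : ∀ i, (C i).graph.Connected) :
    Nat.card (disjointUnion C).graph.ConnectedComponent = t := by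
  have := fun i => (h i).nonempty
  have hreach {x y : Σ i, V i} (hxy : x.1 = y.1) : (disjointUnion C).graph.Reachable x y := by
    obtain ⟨i, a⟩ := x
    obtain ⟨j, b⟩ := y
    obtain rfl : i = j := hxy
    exact ((h i).preconnected a b).map
      (⟨Sigma.mk i, fun h => (disjointUnion_adj C).2 h⟩ : (C i).graph →g (disjointUnion C).graph)
  let f : (disjointUnion C).graph.ConnectedComponent → Fin t :=
    SimpleGraph.ConnectedComponent.lift Sigma.fst (by
      intro x y p _
      induction p with
      | nil => rfl
      | cons hadj _ ih => exact (disjointUnion_fst_eq_of_adj C hadj).trans (ih (by simp_all)))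
  have hf : Function.Bijective f := by
    constructor
    · intro c d
      induction c using SimpleGraph.ConnectedComponent.ind with | _ x
      induction d using SimpleGraph.ConnectedComponent.ind with | _ y
      exact fun hxy => SimpleGraph.ConnectedComponent.sound (hreach hxy)
    · exact fun i => ⟨(disjointUnion C).graph.connectedComponentMk ⟨i, Classical.arbitrary _⟩, rfl⟩
  rw [Nat.card_eq_of_bijective f hf, Nat.card_fin]

theorem excess_disjointUnion (C : ∀ i, SignedGraph (V i)) (h : ∀ i, (C i).graph.Connected) :
    (disjointUnion C).excess = ∑ i, (C i).excess := by
  have := fun i => (h i).nonempty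
  have hnbr (i : Fin t) (a : V i) : ((disjointUnion C).graph.neighborSet ⟨i, a⟩).ncard =
      ((C i).graph.neighborSet a).ncard := by
    rw [← Set.ncard_image_of_injective _ (sigma_mk_injective (i := i))]
    congr 1
    ext ⟨j, b⟩
    constructor
    · intro hadj
      obtain rfl : i = j := disjointUnion_fst_eq_of_adj C hadj
      exact ⟨b, (disjointUnion_adj C).1 hadj, rfl⟩
    · rintro ⟨b, hb, ⟨⟩⟩
      exact (disjointUnion_adj C).2 hb
  simp only [excess, posInertia_disjointUnion, card_connectedComponent_disjointUnion C h,
    Fintype.sum_sigma, hnbr, fun i => card_connectedComponent_of_connected (h i),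
    Finset.sum_add_distrib, ← Finset.mul_sum]
  push_cast
  simp [mul_comm]

end DisjointUnion

end SignedGraph

/-! ### Spectral symmetry of bipartite signed graphs. -/

namespace SignedGraph

section Bipartite

variable {V : Type*} [Fintype V]

open scoped Classical in
/-- The spectrum of a bipartite signed graph is symmetric, so that its rank is twice its positive
inertia index. -/
theorem two_mul_posInertia_of_bipartite (Γ : SignedGraph V) (c : Γ.graph.Coloring Bool) :
    2 * Γ.posInertia =
      (Finset.univ.filter fun i => Γ.adjMatrix_isHermitian.eigenvalues i ≠ 0).card := by
  set hA := Γ.adjMatrix_isHermitian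
  let D : V → ℝ := fun v => if c v then 1 else -1
  have hD (v : V) : D v * D v = 1 := by simp only [D]; split_ifs <;> norm_num
  have hDD : Matrix.diagonal D * Matrix.diagonal D = 1 := by
    simp [Matrix.diagonal_mul_diagonal, hD]
  -- Changing signs on one colour class flips every edge, so A and −A are similar.
  have hconj : Matrix.diagonal D * Γ.adjMatrix * Matrix.diagonal D = -Γ.adjMatrix := by
    ext u v
    rw [Matrix.mul_diagonal, Matrix.diagonal_mul, Matrix.neg_apply]
    by_cases h : Γ.graph.Adj u v
    · have := c.valid h
      simp only [D]
      cases hu : c u <;> cases hv : c v <;> simp_all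
    · simp [adjMatrix_of_not_adj _ h]
  have h1 : (-Γ.adjMatrix).charpoly = Γ.adjMatrix.charpoly := by
    rw [← hconj, Matrix.charpoly_mul_comm, ← mul_assoc, hDD, one_mul]
  have h2 : (-Γ.adjMatrix).charpoly =
      ∏ i, (Polynomial.X - Polynomial.C (-hA.eigenvalues i)) := by
    have hU : (star hA.eigenvectorUnitary.1) * hA.eigenvectorUnitary.1 = 1 :=
      Unitary.coe_star_mul_self hA.eigenvectorUnitary
    have : -Γ.adjMatrix = hA.eigenvectorUnitary.1 *
        (Matrix.diagonal fun i => -hA.eigenvalues i) * star hA.eigenvectorUnitary.1 := by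
      conv_lhs => rw [hA.spectral_theorem, Unitary.conjStarAlgAut_apply]
      rw [← Matrix.diagonal_neg, mul_neg, neg_mul]
      rfl
    rw [this, Matrix.charpoly_mul_comm, ← mul_assoc, hU, one_mul, Matrix.charpoly_diagonal]
  have h3 : Multiset.map (fun i => -hA.eigenvalues i) Finset.univ.val =
      Multiset.map hA.eigenvalues Finset.univ.val := by
    have := hA.roots_charpoly_eq_eigenvalues
    rw [← h1, h2, Polynomial.roots_prod _ _
      (Finset.prod_ne_zero_iff.2 fun i _ => Polynomial.X_sub_C_ne_zero _)] at this
    simpa using this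
  have h4 : (Finset.univ.filter fun i => hA.eigenvalues i < 0).card = Γ.posInertia := by
    have := congrArg (fun s => (Multiset.filter (fun x : ℝ => 0 < x) s).card) h3
    simp only [Multiset.filter_map, Multiset.card_map] at this
    rw [posInertia]
    refine Eq.trans ?_ this
    rw [Finset.card_def, Finset.filter_val]
    exact congrArg Multiset.card (Multiset.filter_congr fun i _ => neg_pos.symm)
  rw [two_mul]
  nth_rewrite 2 [← h4]
  rw [posInertia, ← Finset.card_union_of_disjoint]
  · congr 1
    ext i
    simp only [Finset.mem_union, Finset.mem_filter, Finset.mem_univ, true_and]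
    exact ne_iff_gt_or_lt.symm
  · rw [Finset.disjoint_filter]
    exact fun i _ h => h.le.not_gt

theorem two_mul_posInertia_le_of_bipartite (Γ : SignedGraph V) (c : Γ.graph.Coloring Bool) :
    2 * Γ.posInertia ≤ Fintype.card V := by
  rw [two_mul_posInertia_of_bipartite Γ c]
  exact Finset.card_le_univ _

theorem two_mul_posInertia_lt_iff_of_bipartite [DecidableEq V] (Γ : SignedGraph V)
    (c : Γ.graph.Coloring Bool) : 2 * Γ.posInertia < Fintype.card V ↔ Γ.adjMatrix.det = 0 := by
  rw [two_mul_posInertia_of_bipartite Γ c, Finset.card_lt_iff_ne_univ, ne_eq,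
    Finset.filter_eq_self, Γ.adjMatrix_isHermitian.det_eq_prod_eigenvalues]
  push Not
  simp only [RCLike.ofReal_real_eq_id, id, Finset.prod_eq_zero_iff, Finset.mem_univ, true_and]
  congr!

end Bipartite

end SignedGraph

/-! ### The recurrence satisfied by kernel vectors of a signed cycle. -/

section Recurrence

theorem eq_prod_of_recurrence (σ X : ℕ → ℝ) (h : ∀ k, X (k + 2) = -(σ k * σ (k + 1)) * X k)
    (r j : ℕ) :
    X (r + 2 * j) = (-1) ^ j * (∏ i ∈ Finset.range (2 * j), σ (r + i)) * X r := by
  induction j with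
  | zero => simp
  | succ j ih =>
    rw [show r + 2 * (j + 1) = r + 2 * j + 2 by ring, h, ih,
      show 2 * (j + 1) = 2 * j + 1 + 1 by ring, Finset.prod_range_succ, Finset.prod_range_succ]
    ring_nf

theorem prod_range_add_of_periodic {n : ℕ} {σ : ℕ → ℝ} (hσ : Function.Periodic σ n) (r : ℕ) :
    ∏ i ∈ Finset.range n, σ (r + i) = ∏ i ∈ Finset.range n, σ i := by
  induction r with
  | zero => simp
  | succ r ih =>
    rw [← ih]
    rcases n with _ | n
    · simp
    · rw [Finset.prod_range_succ, Finset.prod_range_succ']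
      have : σ (r + 1 + n) = σ (r + 0) := by
        rw [add_zero, ← hσ r]
        congr 1
        ring
      rw [this]
      congr 1
      exact Finset.prod_congr rfl fun i _ => by congr 1; ring

/-- The solution of the alternating recurrence which starts with `1, 0`. -/
noncomputable def alternatingSolution (σ : ℕ → ℝ) (k : ℕ) : ℝ :=
  if Even k then (-1) ^ (k / 2) * ∏ i ∈ Finset.range k, σ i else 0

theorem alternatingSolution_add_two (σ : ℕ → ℝ) (k : ℕ) :
    alternatingSolution σ (k + 2) = -(σ k * σ (k + 1)) * alternatingSolution σ k := by
  have : Even (k + 2) ↔ Even k := by simp [Nat.even_add]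
  simp only [alternatingSolution, this]
  split_ifs
  · rw [Nat.add_div_right k two_pos, Finset.prod_range_succ, Finset.prod_range_succ, pow_succ]
    ring
  · simp

/-- One full turn multiplies the solution by (−1)^m times the product of the signs, here ((−1)^m)² =
1. -/
theorem alternatingSolution_periodic {m : ℕ} {σ : ℕ → ℝ} (hσ : Function.Periodic σ (2 * m))
    (hP : ∏ i ∈ Finset.range (2 * m), σ i = (-1) ^ m) :
    Function.Periodic (alternatingSolution σ) (2 * m) := by
  intro k
  have : Even (k + 2 * m) ↔ Even k := by simp [Nat.even_add]
  simp only [alternatingSolution, this]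
  split_ifs
  · rw [add_comm k, Finset.prod_range_add, hP, Nat.mul_add_div two_pos, pow_add]
    have h1 : ((-1 : ℝ) ^ m) * (-1) ^ m = 1 := by rw [← mul_pow]; simp
    have h2 : ∏ i ∈ Finset.range k, σ (2 * m + i) = ∏ i ∈ Finset.range k, σ i :=
      Finset.prod_congr rfl fun i _ => by rw [add_comm, hσ]
    rw [h2]
    linear_combination ((-1) ^ (k / 2) * ∏ i ∈ Finset.range k, σ i) * h1
  · rfl

end Recurrence

/-! ### Connected 2-regular graphs are cycles. -/

namespace SimpleGraph

variable {V : Type*} [Finite V] {G : SimpleGraph V}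

theorem neighborSet_toSubgraph_eq (h2 : ∀ v, (G.neighborSet v).ncard = 2) {u v : V}
    {w : G.Walk u u} (hw : w.IsCycle) (hv : v ∈ w.support) :
    w.toSubgraph.neighborSet v = G.neighborSet v :=
  Set.eq_of_subset_of_ncard_le (w.toSubgraph.neighborSet_subset v)
    (by rw [h2, hw.ncard_neighborSet_toSubgraph_eq_two hv]) (Set.toFinite _)

/-- A cycle in a connected graph which is regular of degree two runs through all edges. -/
theorem mem_edges_of_isCycle (hG : G.Connected) (h2 : ∀ v, (G.neighborSet v).ncard = 2) {u : V}
    {w : G.Walk u u} (hw : w.IsCycle) {e : Sym2 V} (he : e ∈ G.edgeSet) : e ∈ w.edges := by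
  have hadj {x y : V} (hx : x ∈ w.support) (h : G.Adj x y) : w.toSubgraph.Adj x y := by
    have : y ∈ w.toSubgraph.neighborSet x := by rwa [neighborSet_toSubgraph_eq h2 hw hx]
    exact this
  have hall (x : V) : x ∈ w.support := by
    have key {a : V} (p : G.Walk a x) (ha : a ∈ w.support) : x ∈ w.support := by
      induction p with
      | nil => exact ha
      | cons h _ ih => exact ih (w.mem_verts_toSubgraph.1 (hadj ha h).snd_mem)
    obtain ⟨p⟩ := hG.preconnected u x
    exact key p w.start_mem_support
  induction e using Sym2.ind with
  | _ x y =>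
    rw [← Walk.mem_edges_toSubgraph, Subgraph.mem_edgeSet]
    exact hadj (hall x) he

/-- A connected graph which is regular of degree two is a cycle. -/
theorem exists_iso_cycleGraph (hG : G.Connected) (h2 : ∀ v, (G.neighborSet v).ncard = 2) :
    ∃ n, 3 ≤ n ∧ Nonempty (cycleGraph n ≃g G) := by
  obtain ⟨v⟩ := hG.nonempty
  have hne : (G.neighborSet v).Nonempty := Set.nonempty_of_ncard_ne_zero (by rw [h2]; simp)
  obtain ⟨w, hw, -⟩ := IsCycles.exists_cycle_toSubgraph_verts_eq_connectedComponentSupp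
    (fun v _ => h2 v : G.IsCycles) (c := G.connectedComponentMk v) rfl hne
  have h3 := hw.three_le_length
  obtain ⟨f⟩ := (cycleGraph_isContained_iff h3).2 ⟨v, w, hw, rfl⟩
  refine ⟨w.length, h3, ?_⟩
  generalize w.length = n at h3 f
  obtain ⟨m, rfl⟩ := Nat.exists_eq_add_of_le' h3
  have himg (i : Fin (m + 3)) : f '' (cycleGraph (m + 3)).neighborSet i = G.neighborSet (f i) := by
    refine Set.eq_of_subset_of_ncard_le ?_ ?_ (Set.toFinite _)
    · rintro _ ⟨j, hj, rfl⟩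
      exact f.toHom.map_adj hj
    · rw [h2, Set.ncard_image_of_injective (f := f) _ f.injective, Set.ncard_eq_toFinset_card',
        Set.toFinset_card, card_neighborSet_eq_degree, cycleGraph_degree_three_le]
  have hsurj : Function.Surjective f := by
    have key {a x : V} (p : G.Walk a x) (ha : a ∈ Set.range f) : x ∈ Set.range f := by
      induction p with
      | nil => exact ha
      | cons h _ ih =>
        obtain ⟨i, rfl⟩ := ha
        obtain ⟨j, -, hj⟩ := (himg i).symm.subset h
        exact ih ⟨j, hj⟩
    intro x
    obtain ⟨p⟩ := hG.preconnected (f 0) x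
    exact key p ⟨0, rfl⟩
  refine ⟨⟨Equiv.ofBijective f ⟨f.injective, hsurj⟩, ?_⟩⟩
  intro i j
  change G.Adj (f i) (f j) ↔ _
  refine ⟨fun h => ?_, fun h => f.toHom.map_adj h⟩
  obtain ⟨k, hk, hkj⟩ := (himg i).symm.subset h
  exact f.injective hkj ▸ hk

end SimpleGraph

/-! ### Signed cycles: singularity, balance and excess. -/

namespace SignedGraph

/-- The entry of the adjacency matrix at an unordered pair of vertices. -/
noncomputable def weight {V : Type*} (Γ : SignedGraph V) : Sym2 V → ℝ :=
  Sym2.lift ⟨Γ.adjMatrix, fun u v => congrFun (congrFun Γ.adjMatrix_transpose v) u⟩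

theorem weight_of_mem {V : Type*} (Γ : SignedGraph V) (e : Γ.graph.edgeSet) :
    Γ.weight e.1 = ((Γ.sign e : ℤ) : ℝ) := by
  obtain ⟨e, he⟩ := e
  induction e using Sym2.ind with
  | _ u v => exact Γ.adjMatrix_of_adj he

theorem walkSign_eq_prod_weight {V : Type*} (Γ : SignedGraph V) {u v : V}
    (w : Γ.graph.Walk u v) : ((Γ.walkSign w : ℤ) : ℝ) = (w.edges.map Γ.weight).prod := by
  have h := map_list_prod (((Int.castRingHom ℝ) : ℤ →* ℝ).comp (Units.coeHom ℤ))
    (w.edges.attach.map fun e => Γ.sign ⟨e.1, w.edges_subset_edgeSet e.2⟩)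
  refine h.trans ?_
  conv_rhs => rw [← List.attach_map_subtype_val w.edges]
  rw [List.map_map, List.map_map]
  congr 2
  funext e
  exact (Γ.weight_of_mem ⟨e.1, w.edges_subset_edgeSet e.2⟩).symm

theorem adjMatrix_sq_of_adj {V : Type*} (Γ : SignedGraph V) {u v : V} (h : Γ.graph.Adj u v) :
    Γ.adjMatrix u v * Γ.adjMatrix u v = 1 := by
  rw [Γ.adjMatrix_of_adj h]
  rcases Int.units_eq_one_or (Γ.sign ⟨s(u, v), h⟩) with h | h <;> simp [h]

section Cycle

open SimpleGraph

variable {m : ℕ} (C : SignedGraph (Fin (m + 3)))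

theorem cycle_adj_add_one (hC : C.graph = cycleGraph (m + 3))
    (i : Fin (m + 3)) : C.graph.Adj i (i + 1) := by
  rw [hC]
  exact Or.inr (by simp)

theorem cycle_connected (hC : C.graph = cycleGraph (m + 3)) :
    C.graph.Connected := hC ▸ cycleGraph_connected

theorem cycle_ncard_neighborSet (hC : C.graph = cycleGraph (m + 3))
    (i : Fin (m + 3)) : (C.graph.neighborSet i).ncard = 2 := by
  rw [hC, Set.ncard_eq_toFinset_card', Set.toFinset_card, card_neighborSet_eq_degree,
    cycleGraph_degree_three_le]

theorem cycle_mulVec (hC : C.graph = cycleGraph (m + 3))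
    (x : Fin (m + 3) → ℝ) (i : Fin (m + 3)) :
    C.adjMatrix.mulVec x (i + 1) =
      C.adjMatrix i (i + 1) * x i + C.adjMatrix (i + 1) (i + 1 + 1) * x (i + 1 + 1) := by
  have hsym : C.adjMatrix i (i + 1) = C.adjMatrix (i + 1) i :=
    congrFun (congrFun C.adjMatrix_transpose (i + 1)) i
  have hne : i ≠ i + 1 + 1 := by
    rw [add_assoc, ne_eq, left_eq_add]
    exact ne_of_beq_false rfl
  rw [hsym]
  simp only [Matrix.mulVec, dotProduct]
  refine Finset.sum_eq_add i (i + 1 + 1) hne (fun j _ hj => ?_) (by simp) (by simp)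
  rw [C.adjMatrix_of_not_adj, zero_mul]
  rw [hC, ← mem_neighborSet, cycleGraph_neighborSet]
  simpa using hj

open scoped Fin.CommRing in
/-- The adjacency matrix of a signed cycle of even length `2 * l` is singular exactly if the
product of the signs is `(-1) ^ l`. -/
theorem cycle_det_eq_zero_iff (hC : C.graph = cycleGraph (m + 3))
    {l : ℕ} (hl : m + 3 = 2 * l) :
    C.adjMatrix.det = 0 ↔ ∏ i, C.adjMatrix i (i + 1) = (-1) ^ l := by
  -- Indexing by natural numbers turns vectors on the cycle into periodic sequences.
  set σ : ℕ → ℝ := fun k => C.adjMatrix (k : Fin (m + 3)) ((k : Fin (m + 3)) + 1) with hσdef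
  have hcast (k : ℕ) : ((k + 2 * l : ℕ) : Fin (m + 3)) = (k : Fin (m + 3)) := by
    rw [← hl]; simp
  have hσ : Function.Periodic σ (2 * l) := fun k => by simp only [hσdef, hcast]
  have hσ1 (k : ℕ) : σ k * σ k = 1 := C.adjMatrix_sq_of_adj (C.cycle_adj_add_one hC _)
  have hP : ∏ i, C.adjMatrix i (i + 1) = ∏ k ∈ Finset.range (2 * l), σ k := by
    rw [← hl, ← Fin.prod_univ_eq_prod_range]
    exact Finset.prod_congr rfl fun i _ => by simp [hσdef]
  have hmul (x : Fin (m + 3) → ℝ) (k : ℕ) : C.adjMatrix.mulVec x ((k + 1 : ℕ) : Fin (m + 3)) =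
      σ k * x (k : ℕ) + σ (k + 1) * x ((k + 2 : ℕ) : Fin (m + 3)) := by
    have := C.cycle_mulVec hC x (k : Fin (m + 3))
    simp only [hσdef]
    push_cast
    rw [this, show (k : Fin (m + 3)) + 2 = k + 1 + 1 by rw [add_assoc, one_add_one_eq_two]]
  rw [← Matrix.exists_mulVec_eq_zero_iff, hP]
  constructor
  · rintro ⟨x, hx, hAx⟩
    obtain ⟨i, hi⟩ := Function.ne_iff.1 hx
    have hrec (k : ℕ) : x ((k + 2 : ℕ) : Fin (m + 3)) = -(σ k * σ (k + 1)) * x (k : ℕ) := by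
      have := (hmul x k).symm.trans (congrFun hAx _)
      simp only [Pi.zero_apply] at this
      linear_combination σ (k + 1) * this - x ((k + 2 : ℕ) : Fin (m + 3)) * hσ1 (k + 1)
    -- Starting at an index with nonzero entry, `l` double steps return to it, so the accumulated
    -- factor is 1.
    have h := eq_prod_of_recurrence σ (fun k => x (k : ℕ)) hrec i.val l
    rw [hcast, prod_range_add_of_periodic hσ] at h
    have hi' : x ((i : ℕ) : Fin (m + 3)) ≠ 0 := by simpa using hi
    have h1 : (-1 : ℝ) ^ l * ∏ k ∈ Finset.range (2 * l), σ k = 1 :=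
      mul_right_cancel₀ hi' (by rw [one_mul]; exact h.symm)
    have h2 : ((-1 : ℝ) ^ l) * (-1) ^ l = 1 := by rw [← mul_pow]; simp
    linear_combination (-1 : ℝ) ^ l * h1 - (∏ k ∈ Finset.range (2 * l), σ k) * h2
  · intro h
    have hper := alternatingSolution_periodic hσ h
    have hval (k : ℕ) : alternatingSolution σ ((k : Fin (m + 3)) : ℕ) =
        alternatingSolution σ k := by
      rw [Fin.val_natCast, hl]
      exact hper.map_mod_nat k
    refine ⟨fun i => alternatingSolution σ i, fun h0 => ?_, ?_⟩
    · have := congrFun h0 0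
      simp [alternatingSolution] at this
    · funext i
      obtain ⟨j, rfl⟩ : ∃ j, i = j + 1 := ⟨i - 1, by simp⟩
      have := hmul (fun i => alternatingSolution σ i) j
      simp only [hval, alternatingSolution_add_two] at this
      rw [Nat.cast_add, Nat.cast_one, Fin.cast_val_eq_self] at this
      rw [this, Pi.zero_apply]
      linear_combination -(σ j) * alternatingSolution σ j * hσ1 (j + 1)

/-- Every closed cycle uses each edge s(i, i + 1) exactly once, so its sign does not depend on its
starting point or direction. -/
theorem cycle_walkSign (hC : C.graph = cycleGraph (m + 3))
    {u : Fin (m + 3)} {w : C.graph.Walk u u} (hw : w.IsCycle) :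
    ((C.walkSign w : ℤ) : ℝ) = ∏ i, C.adjMatrix i (i + 1) := by
  classical
  have hinj : Function.Injective fun i : Fin (m + 3) => s(i, i + 1) := by
    intro i j hij
    rcases Sym2.eq_iff.1 hij with ⟨h, -⟩ | ⟨h, h'⟩
    · exact h
    · rw [h, add_assoc, add_eq_left] at h'
      exact (ne_of_beq_false rfl h').elim
  have hedges : w.edges.toFinset = Finset.univ.image fun i : Fin (m + 3) => s(i, i + 1) := by
    ext e
    simp only [List.mem_toFinset, Finset.mem_image, Finset.mem_univ, true_and]
    constructor
    · intro he
      have := w.edges_subset_edgeSet he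
      induction e using Sym2.ind with
      | _ a b =>
        rw [mem_edgeSet, hC, cycleGraph_adj] at this
        rcases this with h | h
        · exact ⟨b, by rw [← h, add_sub_cancel, Sym2.eq_swap]⟩
        · exact ⟨a, by rw [← h, add_sub_cancel]⟩
    · rintro ⟨i, rfl⟩
      exact mem_edges_of_isCycle (C.cycle_connected hC) (C.cycle_ncard_neighborSet hC) hw
        (C.cycle_adj_add_one hC i)
  rw [walkSign_eq_prod_weight, ← List.prod_toFinset _ hw.isCircuit.isTrail.edges_nodup, hedges,
    Finset.prod_image hinj.injOn]
  rfl

theorem cycle_balanced_iff (hC : C.graph = cycleGraph (m + 3)) :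
    C.Balanced ↔ ∏ i, C.adjMatrix i (i + 1) = 1 := by
  constructor
  · intro h
    have hw : ((cycleGraph.cycle m).mapLe hC.ge).IsCycle :=
      cycleGraph.isCycle_cycle.mapLe hC.ge
    rw [← C.cycle_walkSign hC hw, h _ _ hw]
    simp
  · intro h v w hw
    have := C.cycle_walkSign hC hw
    rw [h] at this
    exact Units.ext (Int.cast_injective (α := ℝ) (by rw [this]; simp))

theorem cycle_prod_eq_neg_one (hC : C.graph = cycleGraph (m + 3))
    (h : ¬ C.Balanced) : ∏ i, C.adjMatrix i (i + 1) = -1 := by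
  rw [cycle_balanced_iff C hC] at h
  refine (mul_self_eq_one_iff.1 ?_).resolve_left h
  rw [← Finset.prod_mul_distrib]
  exact Finset.prod_eq_one fun i _ => C.adjMatrix_sq_of_adj (C.cycle_adj_add_one hC i)

theorem cycle_excess (hC : C.graph = cycleGraph (m + 3)) :
    C.excess = 2 * C.posInertia + 2 - ((m + 3 : ℕ) : ℤ) := by
  rw [excess, card_connectedComponent_of_connected (C.cycle_connected hC)]
  simp only [C.cycle_ncard_neighborSet hC, show degreeWeight 2 = -1 from rfl]
  simp
  ring

theorem cycle_excess_eq_zero_iff (hC : C.graph = cycleGraph (m + 3)) :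
    C.excess = 0 ↔
    (C.Balanced → m + 3 ≡ 0 [MOD 4]) ∧ (¬ C.Balanced → m + 3 ≡ 2 [MOD 4]) := by
  have hex := C.cycle_excess hC
  unfold Nat.ModEq
  rcases Nat.even_or_odd' (m + 3) with ⟨l, hl | hl⟩
  · have hnonneg := (C.excess_of_connected (C.cycle_connected hC)).1
    let c : C.graph.Coloring Bool :=
      (cycleGraph.bicoloring_of_even (m + 3) ⟨l, by omega⟩).comp (Hom.ofLE hC.le)
    have hiff := C.two_mul_posInertia_lt_iff_of_bipartite c
    have hle := C.two_mul_posInertia_le_of_bipartite c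
    rw [C.cycle_det_eq_zero_iff hC hl, Fintype.card_fin] at hiff
    rw [Fintype.card_fin] at hle
    -- The excess is even and at least zero, so it vanishes as soon as it is less than two.
    have h0 : C.excess = 0 ↔ 2 * C.posInertia < m + 3 := by omega
    rw [h0, hiff]
    by_cases hb : C.Balanced
    · rw [(C.cycle_balanced_iff hC).1 hb, eq_comm, neg_one_pow_eq_one_iff_even (by norm_num)]
      simp only [hb, forall_const, not_true_eq_false, false_imp_iff, and_true]
      rw [Nat.even_iff]
      omega
    · rw [C.cycle_prod_eq_neg_one hC hb, eq_comm, neg_one_pow_eq_neg_one_iff_odd (by norm_num)]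
      simp only [hb, false_imp_iff, not_false_eq_true, forall_const, true_and]
      rw [Nat.odd_iff]
      omega
  -- For odd length the excess is odd, and neither congruence can hold.
  · by_cases hb : C.Balanced <;>
    · simp only [hb, forall_const, not_true_eq_false, not_false_eq_true, false_imp_iff, and_true,
        true_and]
      omega

end Cycle

end SignedGraph

/-! ### Decomposition into components and the final equivalence. -/

namespace SignedGraph

variable {V : Type*}

/-- The signed subgraph induced by a set of vertices. -/
def induce (Γ : SignedGraph V) (s : Set V) : SignedGraph s where
  graph := Γ.graph.induce s
  sign e := Γ.sign ((SimpleGraph.Embedding.induce s).toHom.mapEdgeSet e)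

theorem adjMatrix_induce (Γ : SignedGraph V) (s : Set V) (a b : s) :
    (Γ.induce s).adjMatrix a b = Γ.adjMatrix a b := by
  by_cases h : Γ.graph.Adj a b
  · rw [adjMatrix_of_adj _ h, adjMatrix_of_adj (Γ.induce s) (u := a) (v := b) h]
    rfl
  · rw [adjMatrix_of_not_adj _ h, adjMatrix_of_not_adj (Γ.induce s) (u := a) (v := b) h]

theorem isomorphic_disjointUnion_induce (Γ : SignedGraph V) {t : ℕ} (f : V → Fin t)
    (hf : ∀ u v, Γ.graph.Adj u v → f u = f v) :
    Γ.Isomorphic (disjointUnion fun i => Γ.induce {x | f x = i}) := by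
  refine isomorphic_iff.2 ⟨(Equiv.sigmaFiberEquiv f).symm, fun u v => ?_⟩
  change (disjointUnion fun i => Γ.induce {x | f x = i}).adjMatrix
    ⟨f u, ⟨u, rfl⟩⟩ ⟨f v, ⟨v, rfl⟩⟩ = _
  by_cases h : f u = f v
  · have : (⟨f u, ⟨u, rfl⟩⟩ : Σ i, ({x | f x = i} : Set V)) = ⟨f v, ⟨u, h⟩⟩ := by
      refine Sigma.ext h ?_
      congr!
    rw [this, adjMatrix_disjointUnion_same, adjMatrix_induce]
  · rw [adjMatrix_disjointUnion_of_ne _ h, adjMatrix_of_not_adj _ fun h' => h (hf u v h')]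

theorem exists_isomorphic_of_iso {n : ℕ} (Γ : SignedGraph V) {G : SimpleGraph (Fin n)}
    (φ : G ≃g Γ.graph) : ∃ C : SignedGraph (Fin n), C.graph = G ∧ Γ.Isomorphic C := by
  refine ⟨⟨G, fun e => Γ.sign (φ.mapEdgeSet e)⟩, rfl, φ.symm, fun e => ?_⟩
  exact congrArg Γ.sign (φ.mapEdgeSet.apply_symm_apply e)

theorem cycleGraph_excess_eq_zero_iff {n : ℕ} (hn : 3 ≤ n) (C : SignedGraph (Fin n))
    (hC : C.graph = SimpleGraph.cycleGraph n) : C.excess = 0 ↔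
      (C.Balanced → n ≡ 0 [MOD 4]) ∧ (¬ C.Balanced → n ≡ 2 [MOD 4]) := by
  obtain ⟨m, rfl⟩ := Nat.exists_eq_add_of_le' hn
  exact C.cycle_excess_eq_zero_iff hC

/-- A signed graph without isolated vertices whose excess vanishes is a disjoint union of signed
cycles with vanishing excess. -/
theorem exists_isomorphic_disjointUnion_cycles [Fintype V] (Γ : SignedGraph V)
    (hΓ : ∀ c : Γ.graph.ConnectedComponent, 2 ≤ c.supp.ncard) (h0 : Γ.excess = 0) :
    ∃ (t : ℕ) (n : Fin t → ℕ) (C : ∀ i, SignedGraph (Fin (n i))),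
      (∀ i, 3 ≤ n i ∧ (C i).graph = SimpleGraph.cycleGraph (n i)) ∧
        (∀ i, (C i).excess = 0) ∧ Γ.Isomorphic (disjointUnion C) := by
  classical
  obtain ⟨t, ⟨e⟩⟩ := Finite.exists_equiv_fin Γ.graph.ConnectedComponent
  let f : V → Fin t := fun v => e (Γ.graph.connectedComponentMk v)
  have hsupp (i : Fin t) : {x | f x = i} = (e.symm i).supp := by
    ext x
    simp [f, ← Equiv.eq_symm_apply]
  have hconn (i : Fin t) : (Γ.induce {x | f x = i}).graph.Connected := by
    change (Γ.graph.induce {x | f x = i}).Connected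
    rw [hsupp]
    exact (e.symm i).connected_toSimpleGraph
  have hcard (i : Fin t) : 2 ≤ Fintype.card ({x | f x = i} : Set V) := by
    rw [← Nat.card_eq_fintype_card]
    change 2 ≤ Set.ncard {x | f x = i}
    rw [hsupp]
    exact hΓ _
  have hiso := Γ.isomorphic_disjointUnion_induce f fun u v h =>
    congrArg e (SimpleGraph.ConnectedComponent.sound h.reachable)
  -- The nonnegative excesses of the components add up to zero.
  have hz (i : Fin t) : (Γ.induce {x | f x = i}).excess = 0 := by
    rw [hiso.excess_eq, excess_disjointUnion _ hconn] at h0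
    exact (Finset.sum_eq_zero_iff_of_nonneg fun i _ => (excess_of_connected _ (hconn i)).1).1 h0 i
      (Finset.mem_univ i)
  have hcyc (i : Fin t) : ∃ n, 3 ≤ n ∧ ∃ C : SignedGraph (Fin n),
      C.graph = SimpleGraph.cycleGraph n ∧ (Γ.induce {x | f x = i}).Isomorphic C := by
    obtain ⟨n, hn, ⟨φ⟩⟩ := SimpleGraph.exists_iso_cycleGraph (hconn i)
      ((excess_of_connected _ (hconn i)).2 (hz i) (hcard i))
    exact ⟨n, hn, exists_isomorphic_of_iso _ φ⟩
  choose n hn C hC hCiso using hcyc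
  exact ⟨t, n, C, fun i => ⟨hn i, hC i⟩, fun i => (hCiso i).excess_eq ▸ hz i,
    hiso.trans (disjointUnion_isomorphic hCiso)⟩

end SignedGraph

theorem theorem3p2 {V : Type*} [Fintype V] (Γ : SignedGraph V)
    (hΓ : ∀ c : Γ.graph.ConnectedComponent, 2 ≤ c.supp.ncard) :
    (Γ.posInertia : ℝ) =
        ((Fintype.card V : ℝ) - (Γ.pendantCount : ℝ)) / 2 - (Γ.cyclomaticNumber : ℝ) ↔
      ∃ (t : ℕ) (n : Fin t → ℕ) (C : ∀ i, SignedGraph (Fin (n i))),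
        (∀ i, 3 ≤ n i ∧ (C i).graph = SimpleGraph.cycleGraph (n i)) ∧
        ∑ i, n i = Fintype.card V ∧
        (∀ i, ((C i).Balanced → n i ≡ 0 [MOD 4]) ∧ (¬ (C i).Balanced → n i ≡ 2 [MOD 4])) ∧
        Γ.Isomorphic (SignedGraph.disjointUnion C) := by
  rw [Γ.posInertia_eq_iff_excess_eq_zero hΓ]
  constructor
  · intro h
    obtain ⟨t, n, C, hC, h0, hiso⟩ := Γ.exists_isomorphic_disjointUnion_cycles hΓ h
    refine ⟨t, n, C, hC, ?_, fun i => ?_, hiso⟩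
    · obtain ⟨φ, -⟩ := hiso
      rw [Fintype.card_congr φ.toEquiv, Fintype.card_sigma]
      simp
    · exact ((C i).cycleGraph_excess_eq_zero_iff (hC i).1 (hC i).2).1 (h0 i)
  · rintro ⟨t, n, C, hC, -, hmod, hiso⟩
    have hconn (i : Fin t) : (C i).graph.Connected := by
      obtain ⟨m, hm⟩ := Nat.exists_eq_add_of_le' (hC i).1
      rw [(hC i).2, hm]
      exact SimpleGraph.cycleGraph_connected
    rw [hiso.excess_eq, SignedGraph.excess_disjointUnion C hconn]
    exact Finset.sum_eq_zero fun i _ =>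
      ((C i).cycleGraph_excess_eq_zero_iff (hC i).1 (hC i).2).2 (hmod i)
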